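/- Let $k<0$, $0<\xi\le\eta<1$, $\lambda_1,\lambda_2\ge 0$, $I=[0,1]$, and consider the nonlinear four-point problem $$-u''(x)=\psi(x,u,u')\quad(0<x<1),\qquad u'(0)=\lambda_1u(\xi),\quad u'(1)=\lambda_2u(\eta).\tag{1}$$ A lower solution of (1) is a function $c\in C^2(I)$ with $-c''\le\psi(x,c,c')$ on $(0,1)$, $c'(0)=\lambda_1c(\xi)$ and $c'(1)\le\lambda_2c(\eta)$; an upper solution is a function $d\in C^2(I)$ with $-d''\ge\psi(x,d,d')$ on $(0,1)$, $d'(0)=\lambda_1d(\xi)$ and $d'(1)\ge\lambda_2d(\eta)$. Assume: 1. $\sqrt{|k|}\sinh\sqrt{|k|}-\lambda_2\cosh(\sqrt{|k|}\,\eta)\ge0$, $\ \sqrt{|k|}\sinh(\sqrt{|k|}\,\xi)+(\lambda_1-\sqrt{|k|})\cosh(\sqrt{|k|}\,\xi)\le0$, $\ \sqrt{|k|}-\lambda_1\cosh(\sqrt{|k|}\,\xi)>0$, and $$|k|\sinh\sqrt{|k|}-\lambda_2\sqrt{|k|}\cosh(\sqrt{|k|}\,\eta)-\lambda_1\lambda_2\sinh(\sqrt{|k|}(\eta-\xi))+\lambda_1\sqrt{|k|}\cosh(\sqrt{|k|}(\xi-1))\ne0.$$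 2. $c$ is a lower and $d$ an upper solution of (1), with $c\le d$ on $I$. 3. $\psi$ is continuous on $E=\{(x,v,w)\in I\times\mathbb R^2: c(x)\le v\le d(x)\}$. 4. There is a constant $L_1\ge0$ such that $\psi(x,v_2,w)-\psi(x,v_1,w)\ge-L_1(v_2-v_1)$ for all $(x,v_1,w),(x,v_2,w)\in E$ with $v_1\le v_2$. 5. There is a differentiable function $L_2:I\to[0,\infty)$ with $L_2(0)=0$ such that $|\psi(x,v,w_1)-\psi(x,v,w_2)|\le L_2(x)|w_1-w_2|$ for all $(x,v,w_1),(x,v,w_2)\in E$. 6. $L_1+k\le0$ and $(L_1+k)+\sup_{x\in I}\big(L_2'(x)+L_2(x)\sqrt{|k|}\big)\le0$. 7. $\psi(x,d(x),d'(x))-\psi(x,c(x),c'(x))-k(d(x)-c(x))\ge0$ for all $x\in I$. Let $c_0=c$, $d_0=d$, and for $n\ge0$ let $c_{n+1},d_{n+1}\in C^2(I)$ solve, on $(0,1)$, $$-c_{n+1}''-kc_{n+1}=\psi(x,c_n,c_n')-kc_n,\quad c_{n+1}'(0)=\lambda_1c_{n+1}(\xi),\quad c_{n+1}'(1)=\lambda_2c_{n+1}(\eta),$$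 $$-d_{n+1}''-kd_{n+1}=\psi(x,d_n,d_n')-kd_n,\quad d_{n+1}'(0)=\lambda_1d_{n+1}(\xi),\quad d_{n+1}'(1)=\lambda_2d_{n+1}(\eta).$$ Then such sequences exist. For any such sequences, $c_n\le c_{n+1}$, $d_{n+1}\le d_n$ and $c_n\le d_n$ on $I$ for all $n\ge 0$, and there are solutions $y,z\in C^2(I)$ of (1) such that $c_n\to y$, $c_n'\to y'$, $d_n\to z$ and $d_n'\to z'$ uniformly on $I$, and $c\le y\le z\le d$ on $I$. -/

import Mathlib

namespace FourPointBVP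

/-- First derivative of a function on the interval `[0,1]` (one-sided at the end points). -/
noncomputable def d1 (u : ℝ → ℝ) : ℝ → ℝ :=
  derivWithin u (Set.Icc 0 1)

/-- Second derivative of a function on the interval `[0,1]` (one-sided at the end points). -/
noncomputable def d2 (u : ℝ → ℝ) : ℝ → ℝ :=
  derivWithin (d1 u) (Set.Icc 0 1)

/-- `c` is a lower solution of `-u'' = ψ(x,u,u')`, `u'(0) = l₁ u(ξ)`, `u'(1) = l₂ u(η)`. -/
structure IsLowerSolution (ψ : ℝ → ℝ → ℝ → ℝ) (l₁ l₂ ξ η : ℝ) (c : ℝ → ℝ) : Prop where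
  contDiff : ContDiffOn ℝ 2 c (Set.Icc 0 1)
  ineq : ∀ x ∈ Set.Ioo (0 : ℝ) 1, -d2 c x ≤ ψ x (c x) (d1 c x)
  left : d1 c 0 = l₁ * c ξ
  right : d1 c 1 ≤ l₂ * c η

/-- `d` is an upper solution of `-u'' = ψ(x,u,u')`, `u'(0) = l₁ u(ξ)`, `u'(1) = l₂ u(η)`. -/
structure IsUpperSolution (ψ : ℝ → ℝ → ℝ → ℝ) (l₁ l₂ ξ η : ℝ) (d : ℝ → ℝ) : Prop where
  contDiff : ContDiffOn ℝ 2 d (Set.Icc 0 1)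
  ineq : ∀ x ∈ Set.Ioo (0 : ℝ) 1, ψ x (d x) (d1 d x) ≤ -d2 d x
  left : d1 d 0 = l₁ * d ξ
  right : l₂ * d η ≤ d1 d 1

/-- `u` is a solution of `-u'' = ψ(x,u,u')`, `u'(0) = l₁ u(ξ)`, `u'(1) = l₂ u(η)`. -/
structure IsSolution (ψ : ℝ → ℝ → ℝ → ℝ) (l₁ l₂ ξ η : ℝ) (u : ℝ → ℝ) : Prop where
  contDiff : ContDiffOn ℝ 2 u (Set.Icc 0 1)
  eq : ∀ x ∈ Set.Ioo (0 : ℝ) 1, -d2 u x = ψ x (u x) (d1 u x)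
  left : d1 u 0 = l₁ * u ξ
  right : d1 u 1 = l₂ * u η

/-- `u` is a solution of the linear problem
`-u'' - k u = g`, `u'(0) = l₁ u(ξ)`, `u'(1) = l₂ u(η)`. -/
structure IsLinearSolution (k : ℝ) (g : ℝ → ℝ) (l₁ l₂ ξ η : ℝ) (u : ℝ → ℝ) : Prop where
  contDiff : ContDiffOn ℝ 2 u (Set.Icc 0 1)
  eq : ∀ x ∈ Set.Ioo (0 : ℝ) 1, -d2 u x - k * u x = g x
  left : d1 u 0 = l₁ * u ξ
  right : d1 u 1 = l₂ * u η

/-- `us` is a sequence of iterates started at `u₀`: `us 0 = u₀` and `us (n+1)` solves the linear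
problem with right-hand side `ψ(x, us n, (us n)') - k (us n)`. -/
structure IsIteration (ψ : ℝ → ℝ → ℝ → ℝ) (k l₁ l₂ ξ η : ℝ) (u₀ : ℝ → ℝ)
    (us : ℕ → ℝ → ℝ) : Prop where
  zero : ∀ x ∈ Set.Icc (0 : ℝ) 1, us 0 x = u₀ x
  succ : ∀ n, IsLinearSolution k (fun x => ψ x (us n x) (d1 (us n) x) - k * us n x)
    l₁ l₂ ξ η (us (n + 1))

/-- The set `E` of all `(x,v,w)` with `x ∈ [0,1]` and `c(x) ≤ v ≤ d(x)`. -/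
def region (c d : ℝ → ℝ) : Set (ℝ × ℝ × ℝ) :=
  {p | p.1 ∈ Set.Icc (0 : ℝ) 1 ∧ c p.1 ≤ p.2.1 ∧ p.2.1 ≤ d p.1}

/-- The determinant of the linear four-point problem for `k < 0`. -/
noncomputable def detNeg (k l₁ l₂ ξ η : ℝ) : ℝ :=
  |k| * Real.sinh √|k| - l₂ * √|k| * Real.cosh (√|k| * η)
    - l₁ * l₂ * Real.sinh (√|k| * (η - ξ)) + l₁ * √|k| * Real.cosh (√|k| * (ξ - 1))

/-- Convergence in `C¹[0,1]`: uniform convergence of the functions and their derivatives. -/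
def TendstoC1 (us : ℕ → ℝ → ℝ) (u : ℝ → ℝ) : Prop :=
  TendstoUniformlyOn us u Filter.atTop (Set.Icc 0 1) ∧
    TendstoUniformlyOn (fun n => d1 (us n)) (d1 u) Filter.atTop (Set.Icc 0 1)

end FourPointBVP

/-!
Write `k = -m²` with `m > 0`, and call `w ∈ C²[0,1]` a supersolution if `w'' ≤ m² w`,
`w'(0) = l₁ w(ξ)` and `w'(1) ≥ l₂ w(η)`.  The proof rests on three properties of supersolutions,
all obtained from one observation (`IsSupersolution.wronskian_antitoneOn`): if `φ ≥ 0` and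
`φ'' = m² φ`, then the Wronskian `w' φ - w φ'` is nonincreasing.

* `w ≥ 0` (`IsSupersolution.nonneg`).  Let `p = m cosh(m x) + l₁ sinh(m (x - ξ))`, the homogeneous
  solution with `p'(0) = l₁ p(ξ)`.  It is positive, and `p'(1) - l₂ p(η)` is the determinant of the
  problem, which is positive.  The Wronskian of `w` and `p` is nonpositive at `0`, hence
  everywhere, so `w / p` is nonincreasing and the condition at `1` forces `w(1) ≥ 0`.
* `L₂ |w'| ≤ -(L₁ + k) w` (`IsSupersolution.lipschitz_mul_abs_d1_le`).  Comparison with `exp(-m x)`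
  and `sinh(m x)` gives `-m w ≤ w'` and `w' sinh(m x) ≤ m w cosh(m x)`, while the differential
  inequality for `L₂` integrates to `m L₂ ≤ -(L₁ + k) (1 - exp(-m x))`.
* `|w|` and `|w'|` are bounded by a constant times `w(1)` (`IsSupersolution.le_exp_mul`,
  `IsSupersolution.abs_d1_le`), because `w exp(m x)` is nondecreasing.

By the second property the right-hand side `ψ(x, u, u') - k u` increases when a supersolution is
added to `u`, so the first property propagates all the order relations along the iterations.
By the third, the increments of the iterates and of their derivatives are dominated by
those of the bounded monotone sequence of values at `1`, which yields convergence in `C¹` without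
any compactness argument.  The limits solve the nonlinear problem by dominated convergence.
-/

open Set Filter Topology

namespace FourPointBVP

/-! ### Calculus on the unit interval -/

theorem hasDerivWithinAt_d1 {u : ℝ → ℝ} (hu : ContDiffOn ℝ 2 u (Icc 0 1)) {x : ℝ}
    (hx : x ∈ Icc (0 : ℝ) 1) : HasDerivWithinAt u (d1 u x) (Icc 0 1) x :=
  (hu.differentiableOn two_ne_zero x hx).hasDerivWithinAt

theorem contDiffOn_d1 {u : ℝ → ℝ} (hu : ContDiffOn ℝ 2 u (Icc 0 1)) :
    ContDiffOn ℝ 1 (d1 u) (Icc 0 1) :=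
  hu.derivWithin (uniqueDiffOn_Icc zero_lt_one) (by norm_num)

theorem hasDerivWithinAt_d2 {u : ℝ → ℝ} (hu : ContDiffOn ℝ 2 u (Icc 0 1)) {x : ℝ}
    (hx : x ∈ Icc (0 : ℝ) 1) : HasDerivWithinAt (d1 u) (d2 u x) (Icc 0 1) x :=
  ((contDiffOn_d1 hu).differentiableOn one_ne_zero x hx).hasDerivWithinAt

theorem hasDerivAt_d1 {u : ℝ → ℝ} (hu : ContDiffOn ℝ 2 u (Icc 0 1)) {x : ℝ}
    (hx : x ∈ Ioo (0 : ℝ) 1) : HasDerivAt u (d1 u x) x :=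
  (hasDerivWithinAt_d1 hu (Ioo_subset_Icc_self hx)).hasDerivAt (Icc_mem_nhds hx.1 hx.2)

theorem hasDerivAt_d2 {u : ℝ → ℝ} (hu : ContDiffOn ℝ 2 u (Icc 0 1)) {x : ℝ}
    (hx : x ∈ Ioo (0 : ℝ) 1) : HasDerivAt (d1 u) (d2 u x) x :=
  (hasDerivWithinAt_d2 hu (Ioo_subset_Icc_self hx)).hasDerivAt (Icc_mem_nhds hx.1 hx.2)

theorem d1_eq {u v : ℝ → ℝ} {x : ℝ} (hx : x ∈ Icc (0 : ℝ) 1)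
    (h : HasDerivWithinAt u (v x) (Icc 0 1) x) : d1 u x = v x :=
  h.derivWithin (uniqueDiffOn_Icc zero_lt_one x hx)

theorem d2_eq {u v f : ℝ → ℝ} {x : ℝ} (hx : x ∈ Icc (0 : ℝ) 1)
    (hu : ∀ x ∈ Icc (0 : ℝ) 1, HasDerivWithinAt u (v x) (Icc 0 1) x)
    (hv : HasDerivWithinAt v (f x) (Icc 0 1) x) : d2 u x = f x :=
  (hv.congr (fun y hy => d1_eq hy (hu y hy)) (d1_eq hx (hu x hx))).derivWithin
    (uniqueDiffOn_Icc zero_lt_one x hx)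

theorem contDiffOn_two_of_hasDerivWithinAt {u v f : ℝ → ℝ}
    (hu : ∀ x ∈ Icc (0 : ℝ) 1, HasDerivWithinAt u (v x) (Icc 0 1) x)
    (hv : ∀ x ∈ Icc (0 : ℝ) 1, HasDerivWithinAt v (f x) (Icc 0 1) x)
    (hf : ContinuousOn f (Icc 0 1)) : ContDiffOn ℝ 2 u (Icc 0 1) := by
  have hU := uniqueDiffOn_Icc (zero_lt_one' ℝ)
  have h1 : ContDiffOn ℝ 1 v (Icc 0 1) := by
    rw [show (1 : WithTop ℕ∞) = 0 + 1 by norm_num, contDiffOn_succ_iff_derivWithin hU]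
    refine ⟨fun x hx => (hv x hx).differentiableWithinAt, by simp, ?_⟩
    exact contDiffOn_zero.2 (hf.congr fun x hx => d1_eq hx (hv x hx))
  rw [show (2 : WithTop ℕ∞) = 1 + 1 by norm_num, contDiffOn_succ_iff_derivWithin hU]
  exact ⟨fun x hx => (hu x hx).differentiableWithinAt, by simp,
    h1.congr fun x hx => d1_eq hx (hu x hx)⟩

theorem d1_sub {u v : ℝ → ℝ} (hu : ContDiffOn ℝ 2 u (Icc 0 1)) (hv : ContDiffOn ℝ 2 v (Icc 0 1))
    {x : ℝ} (hx : x ∈ Icc (0 : ℝ) 1) : d1 (v - u) x = d1 v x - d1 u x :=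
  d1_eq (v := fun x => d1 v x - d1 u x) hx
    ((hasDerivWithinAt_d1 hv hx).sub (hasDerivWithinAt_d1 hu hx))

theorem d2_sub {u v : ℝ → ℝ} (hu : ContDiffOn ℝ 2 u (Icc 0 1)) (hv : ContDiffOn ℝ 2 v (Icc 0 1))
    {x : ℝ} (hx : x ∈ Icc (0 : ℝ) 1) : d2 (v - u) x = d2 v x - d2 u x :=
  d2_eq (v := fun x => d1 v x - d1 u x) (f := fun x => d2 v x - d2 u x) hx
    (fun _ hy => (hasDerivWithinAt_d1 hv hy).sub (hasDerivWithinAt_d1 hu hy))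
    ((hasDerivWithinAt_d2 hv hx).sub (hasDerivWithinAt_d2 hu hx))

theorem antitoneOn_of_hasDerivWithinAt {f f' : ℝ → ℝ} {a b : ℝ} (ha : 0 ≤ a) (hb : b ≤ 1)
    (hf : ∀ x ∈ Icc (0 : ℝ) 1, HasDerivWithinAt f (f' x) (Icc 0 1) x)
    (hf' : ∀ x ∈ Ioo a b, f' x ≤ 0) : AntitoneOn f (Icc a b) := by
  have hs : Icc a b ⊆ Icc (0 : ℝ) 1 := Icc_subset_Icc ha hb
  have hd : ∀ x ∈ Ioo a b, HasDerivAt f (f' x) x := fun x hx =>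
    (hf x (hs (Ioo_subset_Icc_self hx))).hasDerivAt
      (Icc_mem_nhds (ha.trans_lt hx.1) (hx.2.trans_le hb))
  refine antitoneOn_of_deriv_nonpos (convex_Icc a b)
    (fun x hx => (hf x (hs hx)).continuousWithinAt.mono hs) ?_ ?_
  · rw [interior_Icc]
    exact fun x hx => (hd x hx).differentiableAt.differentiableWithinAt
  · rw [interior_Icc]
    intro x hx
    rw [(hd x hx).deriv]
    exact hf' x hx

/-- Composition with the projection `max 0 (min 1 x)` onto `[0,1]` extends a continuous function to
the whole line, where the fundamental theorem of calculus applies without endpoint conditions. -/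
theorem continuous_comp_clamp {g : ℝ → ℝ} (hg : ContinuousOn g (Icc 0 1)) :
    Continuous fun x => g (max 0 (min 1 x)) :=
  hg.comp_continuous (by fun_prop) fun x =>
    ⟨le_max_left _ _, max_le zero_le_one (min_le_left _ _)⟩

theorem clamp_eq {x : ℝ} (hx : x ∈ Icc (0 : ℝ) 1) : max 0 (min 1 x) = x := by
  rw [min_eq_right hx.2, max_eq_right hx.1]

/-! ### Limits of functions and of their derivatives -/

/-- Termwise differentiation on the closed interval under dominated pointwise convergence of the
derivatives, the derivatives being prescribed in the open interval only. -/
theorem hasDerivWithinAt_of_tendsto {f f' : ℕ → ℝ → ℝ} {g g' : ℝ → ℝ} {B : ℝ}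
    (hf : ∀ n, ContinuousOn (f n) (Icc 0 1))
    (hf' : ∀ n, ∀ x ∈ Ioo (0 : ℝ) 1, HasDerivAt (f n) (f' n x) x)
    (hcont : ∀ n, ContinuousOn (f' n) (Icc 0 1))
    (hB : ∀ᶠ n in atTop, ∀ x ∈ Icc (0 : ℝ) 1, |f' n x| ≤ B)
    (hg : ∀ x ∈ Icc (0 : ℝ) 1, Tendsto (fun n => f n x) atTop (𝓝 (g x)))
    (hg' : ∀ x ∈ Icc (0 : ℝ) 1, Tendsto (fun n => f' n x) atTop (𝓝 (g' x)))
    (hg'c : ContinuousOn g' (Icc 0 1)) {x : ℝ} (hx : x ∈ Icc (0 : ℝ) 1) :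
    HasDerivWithinAt g (g' x) (Icc 0 1) x := by
  have hsub : ∀ {y : ℝ}, y ∈ Icc (0 : ℝ) 1 → Icc 0 y ⊆ Icc (0 : ℝ) 1 := fun hy =>
    Icc_subset_Icc_right hy.2
  have hint : ∀ y ∈ Icc (0 : ℝ) 1, g y = g 0 + ∫ t in (0 : ℝ)..y, g' (max 0 (min 1 t)) := by
    intro y hy
    have hI : ∀ n, ∫ t in (0 : ℝ)..y, f' n t = f n y - f n 0 := fun n =>
      intervalIntegral.integral_eq_sub_of_hasDerivAt_of_le hy.1 ((hf n).mono (hsub hy))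
        (fun t ht => hf' n t ⟨ht.1, ht.2.trans_le hy.2⟩)
        ((hcont n).mono (by rw [uIcc_of_le hy.1]; exact hsub hy)).intervalIntegrable
    have hmem : ∀ t ∈ uIoc 0 y, t ∈ Icc (0 : ℝ) 1 := fun t ht => by
      rw [uIoc_of_le hy.1] at ht
      exact ⟨ht.1.le, ht.2.trans hy.2⟩
    have hlim : Tendsto (fun n => ∫ t in (0 : ℝ)..y, f' n t) atTop
        (𝓝 (∫ t in (0 : ℝ)..y, g' (max 0 (min 1 t)))) := by
      refine intervalIntegral.tendsto_integral_filter_of_dominated_convergence (fun _ => B)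
        (Eventually.of_forall fun n => ?_) ?_ intervalIntegrable_const ?_
      · exact ((hcont n).mono hmem).aestronglyMeasurable measurableSet_uIoc
      · filter_upwards [hB] with n hn
        exact Eventually.of_forall fun t ht => hn t (hmem t ht)
      · refine Eventually.of_forall fun t ht => ?_
        rw [clamp_eq (hmem t ht)]
        exact hg' t (hmem t ht)
    have := tendsto_nhds_unique hlim
      (((hg y hy).sub (hg 0 (by simp))).congr fun n => (hI n).symm)
    linarith
  have hG := continuous_comp_clamp hg'c
  have hd := ((hG.integral_hasStrictDerivAt 0 x).hasDerivAt.const_add (g 0)).hasDerivWithinAt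
    (s := Icc 0 1)
  rw [clamp_eq hx] at hd
  exact hd.congr hint (hint x hx)

/-- A sequence of functions whose increments are dominated by those of a bounded monotone
sequence of reals converges uniformly. -/
theorem exists_tendstoUniformlyOn_of_increments {f : ℕ → ℝ → ℝ} {s : Set ℝ} {a : ℕ → ℝ} {A C : ℝ}
    (hf : ∀ n, ∀ x ∈ s, |f (n + 1) x - f n x| ≤ C * (a (n + 1) - a n))
    (ha : ∀ n, a n ≤ a (n + 1)) (hA : ∀ n, a n ≤ A) :
    ∃ g, TendstoUniformlyOn f g atTop s := by
  have hsum : Summable fun n => C * (a (n + 1) - a n) := by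
    refine Summable.mul_left C (summable_of_sum_range_le (c := A - a 0)
      (fun n => sub_nonneg.2 (ha n)) fun n => ?_)
    rw [Finset.sum_range_sub]
    linarith [hA n]
  have hd : ∀ x ∈ s, ∀ n, dist (f n x) (f n.succ x) ≤ C * (a (n + 1) - a n) := fun x hx n => by
    rw [dist_comm, Real.dist_eq]
    exact hf n x hx
  have hlim : ∀ x, ∃ l, x ∈ s → Tendsto (fun n => f n x) atTop (𝓝 l) := fun x => by
    by_cases hx : x ∈ s
    · obtain ⟨l, hl⟩ := cauchySeq_tendsto_of_complete
        (cauchySeq_of_dist_le_of_summable _ (hd x hx) hsum)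
      exact ⟨l, fun _ => hl⟩
    · exact ⟨0, fun h => absurd h hx⟩
  choose g hg using hlim
  refine ⟨g, Metric.tendstoUniformlyOn_iff.2 fun ε hε => ?_⟩
  have htail := tendsto_sum_nat_add fun n => C * (a (n + 1) - a n)
  filter_upwards [htail.eventually (gt_mem_nhds hε)] with n hn x hx
  rw [dist_comm]
  refine (dist_le_tsum_of_dist_le_of_tendsto _ (hd x hx) hsum (hg x hx) n).trans_lt ?_
  simpa only [add_comm n] using hn

/-! ### Supersolutions of the linear problem -/

/-- The conditions on the parameters of the linear problem `-u'' + m² u = h`, `u'(0) = l₁ u(ξ)`,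
`u'(1) = l₂ u(η)` under which it is uniquely solvable and inverse positive. -/
structure IsPositiveProblem (m l₁ l₂ ξ η : ℝ) : Prop where
  m_pos : 0 < m
  l₁_nonneg : 0 ≤ l₁
  l₂_nonneg : 0 ≤ l₂
  ξ_pos : 0 < ξ
  ξ_lt : ξ < 1
  η_pos : 0 < η
  η_lt : η < 1
  sinh_lt : l₁ * Real.sinh (m * ξ) < m
  det_pos : 0 < m ^ 2 * Real.sinh m - l₂ * m * Real.cosh (m * η)
    - l₁ * l₂ * Real.sinh (m * (η - ξ)) + l₁ * m * Real.cosh (m * (ξ - 1))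

/-- The determinant is nonnegative as soon as `l₂ cosh(m η) ≤ m sinh m`, by the identity
`cosh(m (ξ - 1)) cosh(m η) - sinh m sinh(m (η - ξ)) = cosh(m (1 - η)) cosh(m ξ)`. -/
theorem det_nonneg {m l₁ l₂ ξ η : ℝ} (hm : 0 < m) (hl₁ : 0 ≤ l₁) (hξη : ξ ≤ η)
    (h : l₂ * Real.cosh (m * η) ≤ m * Real.sinh m) :
    0 ≤ m ^ 2 * Real.sinh m - l₂ * m * Real.cosh (m * η)
      - l₁ * l₂ * Real.sinh (m * (η - ξ)) + l₁ * m * Real.cosh (m * (ξ - 1)) := by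
  have hc : 0 < Real.cosh (m * η) := Real.cosh_pos _
  have hs : 0 ≤ Real.sinh (m * (η - ξ)) :=
    Real.sinh_nonneg_iff.2 (mul_nonneg hm.le (sub_nonneg.2 hξη))
  have hid : Real.cosh (m * (ξ - 1)) * Real.cosh (m * η) - Real.sinh m * Real.sinh (m * (η - ξ))
      = Real.cosh (m * (1 - η)) * Real.cosh (m * ξ) := by
    have e1 : m * (ξ - 1) = m * ξ - m := by ring
    have e2 : m * (η - ξ) = m * η - m * ξ := by ring
    have e3 : m * (1 - η) = m - m * η := by ring
    rw [e1, e2, e3, Real.cosh_sub, Real.sinh_sub, Real.cosh_sub]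
    ring
  have h2 : 0 ≤ m * Real.cosh (m * (ξ - 1)) - l₂ * Real.sinh (m * (η - ξ)) := by
    refine nonneg_of_mul_nonneg_left ?_ hc
    have h3 := mul_le_mul_of_nonneg_right h hs
    have h4 : 0 ≤ m * (Real.cosh (m * (1 - η)) * Real.cosh (m * ξ)) := by positivity
    rw [← hid] at h4
    linarith
  have h5 := mul_nonneg hl₁ h2
  have h6 := mul_nonneg hm.le (sub_nonneg.2 h)
  linarith

/-- `w'' ≤ m² w` on `(0,1)`, `w'(0) = l₁ w(ξ)`, `w'(1) ≥ l₂ w(η)`. -/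
structure IsSupersolution (m l₁ l₂ ξ η : ℝ) (w : ℝ → ℝ) : Prop where
  contDiff : ContDiffOn ℝ 2 w (Icc 0 1)
  ineq : ∀ x ∈ Ioo (0 : ℝ) 1, d2 w x ≤ m ^ 2 * w x
  left : d1 w 0 = l₁ * w ξ
  right : l₂ * w η ≤ d1 w 1

section Supersolution

variable {m l₁ l₂ ξ η : ℝ} {w : ℝ → ℝ}

theorem isSupersolution_sub {u v : ℝ → ℝ} (hu : ContDiffOn ℝ 2 u (Icc 0 1))
    (hv : ContDiffOn ℝ 2 v (Icc 0 1))
    (h : ∀ x ∈ Ioo (0 : ℝ) 1, -d2 u x + m ^ 2 * u x ≤ -d2 v x + m ^ 2 * v x)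
    (hu0 : d1 u 0 = l₁ * u ξ) (hv0 : d1 v 0 = l₁ * v ξ)
    (hu1 : d1 u 1 ≤ l₂ * u η) (hv1 : l₂ * v η ≤ d1 v 1) :
    IsSupersolution m l₁ l₂ ξ η (v - u) where
  contDiff := hv.sub hu
  ineq x hx := by
    rw [d2_sub hu hv (Ioo_subset_Icc_self hx), Pi.sub_apply]
    linarith [h x hx]
  left := by
    rw [d1_sub hu hv (by simp), Pi.sub_apply, hu0, hv0]
    ring
  right := by
    rw [d1_sub hu hv (by simp), Pi.sub_apply]
    linarith

theorem IsSupersolution.wronskian_antitoneOn (hw : IsSupersolution m l₁ l₂ ξ η w)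
    {φ φ' : ℝ → ℝ} {a b : ℝ} (ha : 0 ≤ a) (hb : b ≤ 1)
    (hφ : ∀ x, HasDerivAt φ (φ' x) x) (hφ' : ∀ x, HasDerivAt φ' (m ^ 2 * φ x) x)
    (hpos : ∀ x ∈ Ioo a b, 0 ≤ φ x) :
    AntitoneOn (fun x => d1 w x * φ x - w x * φ' x) (Icc a b) := by
  refine antitoneOn_of_hasDerivWithinAt ha hb
    (f' := fun x => (d2 w x * φ x + d1 w x * φ' x) - (d1 w x * φ' x + w x * (m ^ 2 * φ x)))
    (fun x hx => ((hasDerivWithinAt_d2 hw.contDiff hx).mul (hφ x).hasDerivWithinAt).sub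
      ((hasDerivWithinAt_d1 hw.contDiff hx).mul (hφ' x).hasDerivWithinAt)) fun x hx => ?_
  have := mul_nonneg (sub_nonneg.2 (hw.ineq x ⟨ha.trans_lt hx.1, hx.2.trans_le hb⟩)) (hpos x hx)
  linarith

theorem hasDerivAt_sinh_mul (m a x : ℝ) :
    HasDerivAt (fun x => Real.sinh (m * (x - a))) (m * Real.cosh (m * (x - a))) x := by
  have := (((hasDerivAt_id x).sub_const a).const_mul m).sinh
  simpa [mul_comm] using this

theorem hasDerivAt_cosh_mul (m a x : ℝ) :
    HasDerivAt (fun x => Real.cosh (m * (x - a))) (m * Real.sinh (m * (x - a))) x := by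
  have := (((hasDerivAt_id x).sub_const a).const_mul m).cosh
  simpa [mul_comm] using this

/-- The solution of `p'' = m² p`, `p'(0) = l₁ p(ξ)`, normalised by `p(0) = m - l₁ sinh(m ξ)`. -/
noncomputable def homSol (m l₁ ξ x : ℝ) : ℝ :=
  m * Real.cosh (m * (x - 0)) + l₁ * Real.sinh (m * (x - ξ))

/-- The derivative of `homSol`. -/
noncomputable def homSolDeriv (m l₁ ξ x : ℝ) : ℝ :=
  m * (m * Real.sinh (m * (x - 0))) + l₁ * (m * Real.cosh (m * (x - ξ)))

theorem hasDerivAt_homSol (m l₁ ξ x : ℝ) : HasDerivAt (homSol m l₁ ξ) (homSolDeriv m l₁ ξ x) x :=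
  ((hasDerivAt_cosh_mul m 0 x).const_mul m).add ((hasDerivAt_sinh_mul m ξ x).const_mul l₁)

theorem hasDerivAt_homSolDeriv (m l₁ ξ x : ℝ) :
    HasDerivAt (homSolDeriv m l₁ ξ) (m ^ 2 * homSol m l₁ ξ x) x := by
  refine ((((hasDerivAt_sinh_mul m 0 x).const_mul m).const_mul m).add
    (((hasDerivAt_cosh_mul m ξ x).const_mul m).const_mul l₁)).congr_deriv ?_
  simp only [homSol]
  ring

theorem homSol_zero (m l₁ ξ : ℝ) : homSol m l₁ ξ 0 = m - l₁ * Real.sinh (m * ξ) := by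
  simp [homSol, Real.sinh_neg]
  ring

theorem homSolDeriv_zero (m l₁ ξ : ℝ) :
    homSolDeriv m l₁ ξ 0 = l₁ * (m * Real.cosh (m * ξ)) := by
  simp [homSolDeriv, Real.cosh_neg]

theorem IsPositiveProblem.homSol_pos (hP : IsPositiveProblem m l₁ l₂ ξ η) {x : ℝ} (hx : 0 ≤ x) :
    0 < homSol m l₁ ξ x := by
  have h1 : 1 ≤ Real.cosh (m * (x - 0)) := Real.one_le_cosh _
  have h2 : -Real.sinh (m * ξ) ≤ Real.sinh (m * (x - ξ)) := by
    rw [← Real.sinh_neg, Real.sinh_le_sinh]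
    nlinarith [mul_nonneg hP.m_pos.le hx]
  have h3 := mul_le_mul_of_nonneg_left h1 hP.m_pos.le
  have h4 := mul_le_mul_of_nonneg_left h2 hP.l₁_nonneg
  have := hP.sinh_lt
  unfold homSol
  linarith

theorem IsPositiveProblem.homSol_right (hP : IsPositiveProblem m l₁ l₂ ξ η) :
    0 < homSolDeriv m l₁ ξ 1 - l₂ * homSol m l₁ ξ η := by
  have h := hP.det_pos
  have e : m * (ξ - 1) = -(m * (1 - ξ)) := by ring
  rw [e, Real.cosh_neg] at h
  simp only [homSol, homSolDeriv, sub_zero, mul_one]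
  linarith

theorem IsSupersolution.nonneg (hP : IsPositiveProblem m l₁ l₂ ξ η)
    (hw : IsSupersolution m l₁ l₂ ξ η w) {x : ℝ} (hx : x ∈ Icc (0 : ℝ) 1) : 0 ≤ w x := by
  have hm := hP.m_pos
  -- Comparison on `[0, ξ]` with `sinh(m (ξ - x))` bounds `w(ξ)` by the data of `w` at `0`.
  have h0 : m * w ξ ≤ d1 w 0 * Real.sinh (m * ξ) + w 0 * (m * Real.cosh (m * ξ)) := by
    have := hw.wronskian_antitoneOn (φ := fun x => -Real.sinh (m * (x - ξ)))
      (φ' := fun x => -(m * Real.cosh (m * (x - ξ)))) le_rfl hP.ξ_lt.le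
      (fun x => (hasDerivAt_sinh_mul m ξ x).neg)
      (fun x => (((hasDerivAt_cosh_mul m ξ x).const_mul m).neg).congr_deriv (by ring))
      (fun x hx => by
        rw [← Real.sinh_neg, Real.sinh_nonneg_iff]
        nlinarith [mul_nonneg hm.le (sub_nonneg.2 hx.2.le)])
      (left_mem_Icc.2 hP.ξ_pos.le) (right_mem_Icc.2 hP.ξ_pos.le) hP.ξ_pos.le
    simp [Real.sinh_neg, Real.cosh_neg] at this
    linarith
  have hW0 : d1 w 0 * homSol m l₁ ξ 0 - w 0 * homSolDeriv m l₁ ξ 0 ≤ 0 := by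
    rw [homSol_zero, homSolDeriv_zero]
    have := mul_le_mul_of_nonneg_left h0 hP.l₁_nonneg
    have e := hw.left
    have : m * d1 w 0 = l₁ * (m * w ξ) := by rw [e]; ring
    linarith
  have hW : ∀ y ∈ Icc (0 : ℝ) 1,
      d1 w y * homSol m l₁ ξ y - w y * homSolDeriv m l₁ ξ y ≤ 0 := fun y hy =>
    (hw.wronskian_antitoneOn le_rfl le_rfl (hasDerivAt_homSol m l₁ ξ)
      (hasDerivAt_homSolDeriv m l₁ ξ) (fun z hz => (hP.homSol_pos hz.1.le).le)
      (by simp) hy hy.1).trans hW0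
  have hq : AntitoneOn (fun y => w y / homSol m l₁ ξ y) (Icc 0 1) := by
    refine antitoneOn_of_hasDerivWithinAt le_rfl le_rfl
      (f' := fun y => (d1 w y * homSol m l₁ ξ y - w y * homSolDeriv m l₁ ξ y)
        / homSol m l₁ ξ y ^ 2)
      (fun y hy => (hasDerivWithinAt_d1 hw.contDiff hy).div
        (hasDerivAt_homSol m l₁ ξ y).hasDerivWithinAt (hP.homSol_pos hy.1).ne') fun y hy => ?_
    exact div_nonpos_of_nonpos_of_nonneg (hW y (Ioo_subset_Icc_self hy)) (sq_nonneg _)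
  have h1m : (1 : ℝ) ∈ Icc (0 : ℝ) 1 := by simp
  have hp1 := hP.homSol_pos zero_le_one
  set v := w 1 / homSol m l₁ ξ 1 with hv
  have hw1 : w 1 = v * homSol m l₁ ξ 1 := by rw [hv]; field_simp
  have hle : ∀ y ∈ Icc (0 : ℝ) 1, v * homSol m l₁ ξ y ≤ w y := fun y hy =>
    (le_div_iff₀ (hP.homSol_pos hy.1)).1 (hq hy h1m hy.2)
  -- The condition at `1` reads `v (p'(1) - l₂ p(η)) ≥ 0`.
  have hv0 : 0 ≤ v := by
    refine nonneg_of_mul_nonneg_left ?_ hP.homSol_right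
    have h1 : d1 w 1 ≤ v * homSolDeriv m l₁ ξ 1 := by
      refine le_of_mul_le_mul_right ?_ hp1
      have := hW 1 h1m
      rw [hw1] at this
      linarith
    have h2 := mul_le_mul_of_nonneg_left (hle η ⟨hP.η_pos.le, hP.η_lt.le⟩) hP.l₂_nonneg
    have h3 := hw.right
    linarith
  exact (mul_nonneg hv0 (hP.homSol_pos hx.1).le).trans (hle x hx)

theorem IsSupersolution.neg_mul_le_d1 (hP : IsPositiveProblem m l₁ l₂ ξ η)
    (hw : IsSupersolution m l₁ l₂ ξ η w) {x : ℝ} (hx : x ∈ Icc (0 : ℝ) 1) :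
    -(m * w x) ≤ d1 w x := by
  have hd : ∀ x, HasDerivAt (fun x => Real.exp (-m * x)) (-m * Real.exp (-m * x)) x := fun x => by
    simpa [mul_comm] using ((hasDerivAt_id x).const_mul (-m)).exp
  have h1m : (1 : ℝ) ∈ Icc (0 : ℝ) 1 := by simp
  have h := hw.wronskian_antitoneOn le_rfl le_rfl hd
    (fun x => ((hd x).const_mul (-m)).congr_deriv (by ring))
    (fun x _ => (Real.exp_pos _).le) hx h1m hx.2
  have hw1 : 0 ≤ d1 w 1 :=
    (mul_nonneg hP.l₂_nonneg (hw.nonneg hP ⟨hP.η_pos.le, hP.η_lt.le⟩)).trans hw.right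
  have h1 : 0 ≤ (d1 w 1 + m * w 1) * Real.exp (-m * 1) :=
    mul_nonneg (add_nonneg hw1 (mul_nonneg hP.m_pos.le (hw.nonneg hP h1m))) (Real.exp_pos _).le
  have h2 : 0 ≤ (d1 w x + m * w x) * Real.exp (-m * x) := by
    simp only at h
    linarith
  linarith [nonneg_of_mul_nonneg_left h2 (Real.exp_pos (-m * x))]

/-- This weakens `w' ≤ m coth(m x) w` by `coth(m x) ≤ 1 / (1 - exp(-m x))`, so as to match
`mul_lipschitz_le`. -/
theorem IsSupersolution.one_sub_exp_mul_d1_le (hP : IsPositiveProblem m l₁ l₂ ξ η)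
    (hw : IsSupersolution m l₁ l₂ ξ η w) {x : ℝ} (hx : x ∈ Icc (0 : ℝ) 1) :
    (1 - Real.exp (-(m * x))) * d1 w x ≤ m * w x := by
  have hm := hP.m_pos
  have h0m : (0 : ℝ) ∈ Icc (0 : ℝ) 1 := by simp
  have h := hw.wronskian_antitoneOn le_rfl le_rfl (hasDerivAt_sinh_mul m 0)
    (fun x => ((hasDerivAt_cosh_mul m 0 x).const_mul m).congr_deriv (by ring))
    (fun x hx => Real.sinh_nonneg_iff.2 (by nlinarith [mul_nonneg hm.le hx.1.le])) h0m hx hx.1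
  simp only [sub_zero, mul_zero, Real.sinh_zero, Real.cosh_zero, mul_one] at h
  have hmw : 0 ≤ m * w x := mul_nonneg hm.le (hw.nonneg hP hx)
  have hw0 : 0 ≤ m * w 0 := mul_nonneg hm.le (hw.nonneg hP h0m)
  have hmul : Real.exp (m * x) * Real.exp (-(m * x)) = 1 := by
    rw [← Real.exp_add, add_neg_cancel, Real.exp_zero]
  rw [Real.sinh_eq, Real.cosh_eq] at h
  set q := Real.exp (-(m * x)) with hq
  set r := Real.exp (m * x)
  have hq0 : 0 < q := Real.exp_pos _
  have hq1 : q ≤ 1 := Real.exp_le_one_iff.2 (neg_nonpos.2 (mul_nonneg hm.le hx.1))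
  -- Multiplied by `2 q`, the comparison with `sinh` reads `w' (1 - q²) ≤ m w (1 + q²)`.
  have h2 : d1 w x * (1 - q ^ 2) ≤ m * w x * (1 + q ^ 2) := by
    have h3 : d1 w x * (r - q) ≤ m * w x * (r + q) := by linarith
    have h4 := mul_le_mul_of_nonneg_right h3 hq0.le
    have e1 : d1 w x * (r - q) * q = d1 w x * (r * q - q ^ 2) := by ring
    have e2 : m * w x * (r + q) * q = m * w x * (r * q + q ^ 2) := by ring
    rwa [e1, e2, hmul] at h4
  have h5 : m * w x * (1 + q ^ 2) ≤ m * w x * (1 + q) :=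
    mul_le_mul_of_nonneg_left (by nlinarith) hmw
  refine le_of_mul_le_mul_right ?_ (show 0 < 1 + q by linarith)
  linarith

theorem IsSupersolution.le_exp_mul (hP : IsPositiveProblem m l₁ l₂ ξ η)
    (hw : IsSupersolution m l₁ l₂ ξ η w) {x : ℝ} (hx : x ∈ Icc (0 : ℝ) 1) :
    w x ≤ Real.exp m * w 1 := by
  have hd : ∀ x, HasDerivAt (fun x => Real.exp (m * x)) (m * Real.exp (m * x)) x := fun x => by
    simpa [mul_comm] using ((hasDerivAt_id x).const_mul m).exp
  have h : AntitoneOn (fun x => -(w x * Real.exp (m * x))) (Icc 0 1) := by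
    refine antitoneOn_of_hasDerivWithinAt le_rfl le_rfl
      (f' := fun x => -(d1 w x * Real.exp (m * x) + w x * (m * Real.exp (m * x))))
      (fun x hx => ((hasDerivWithinAt_d1 hw.contDiff hx).mul (hd x).hasDerivWithinAt).neg)
      fun x hx => ?_
    have h1 := hw.neg_mul_le_d1 hP (Ioo_subset_Icc_self hx)
    have h2 : 0 ≤ (d1 w x + m * w x) * Real.exp (m * x) :=
      mul_nonneg (by linarith) (Real.exp_pos _).le
    linarith
  have h1 := h hx (show (1 : ℝ) ∈ Icc (0 : ℝ) 1 by simp) hx.2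
  simp only [mul_one] at h1
  have h2 : w x * 1 ≤ w x * Real.exp (m * x) := mul_le_mul_of_nonneg_left
    (Real.one_le_exp (mul_nonneg hP.m_pos.le hx.1)) (hw.nonneg hP hx)
  linarith

theorem IsSupersolution.abs_d1_le (hP : IsPositiveProblem m l₁ l₂ ξ η)
    (hw : IsSupersolution m l₁ l₂ ξ η w) {x : ℝ} (hx : x ∈ Icc (0 : ℝ) 1) :
    |d1 w x| ≤ (l₁ + m + m ^ 2) * Real.exp m * w 1 := by
  have hm := hP.m_pos
  set K := Real.exp m * w 1
  have hK : 0 ≤ K := mul_nonneg (Real.exp_pos _).le (hw.nonneg hP (by simp))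
  have hwK : ∀ y ∈ Icc (0 : ℝ) 1, w y ≤ K := fun y hy => hw.le_exp_mul hP hy
  have h : AntitoneOn (fun x => d1 w x - x * (m ^ 2 * K)) (Icc 0 1) := by
    refine antitoneOn_of_hasDerivWithinAt le_rfl le_rfl (f' := fun x => d2 w x - 1 * (m ^ 2 * K))
      (fun x hx => (hasDerivWithinAt_d2 hw.contDiff hx).sub
        ((hasDerivWithinAt_id x _).mul_const _)) fun x hx => ?_
    have h1 := mul_le_mul_of_nonneg_left (hwK x (Ioo_subset_Icc_self hx)) (sq_nonneg m)
    have h2 := hw.ineq x hx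
    linarith
  have h1 := h (show (0 : ℝ) ∈ Icc (0 : ℝ) 1 by simp) hx hx.1
  simp only [zero_mul, sub_zero] at h1
  have h2 : x * (m ^ 2 * K) ≤ 1 * (m ^ 2 * K) :=
    mul_le_mul_of_nonneg_right hx.2 (by positivity)
  have h3 := mul_le_mul_of_nonneg_left (hwK ξ ⟨hP.ξ_pos.le, hP.ξ_lt.le⟩) hP.l₁_nonneg
  have h4 := mul_le_mul_of_nonneg_left (hwK x hx) hm.le
  have h5 := hw.neg_mul_le_d1 hP hx
  have h6 := hw.left
  have h7 : 0 ≤ m * K := by positivity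
  have h8 : 0 ≤ m ^ 2 * K := by positivity
  have h9 := mul_nonneg hP.l₁_nonneg hK
  rw [mul_assoc, abs_le]
  change -((l₁ + m + m ^ 2) * K) ≤ _ ∧ _ ≤ (l₁ + m + m ^ 2) * K
  constructor <;> linarith

/-- The differential inequality for `L₂`, integrated with the integrating factor `exp(m x)`. -/
theorem mul_lipschitz_le (hm : 0 < m) {L₂ : ℝ → ℝ} {M : ℝ} (hL0 : L₂ 0 = 0)
    (hLd : DifferentiableOn ℝ L₂ (Icc 0 1))
    (hL : ∀ x ∈ Icc (0 : ℝ) 1, d1 L₂ x + L₂ x * m ≤ M) {x : ℝ} (hx : x ∈ Icc (0 : ℝ) 1) :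
    m * L₂ x ≤ M * (1 - Real.exp (-(m * x))) := by
  have hd : ∀ x, HasDerivAt (fun x => Real.exp (m * x)) (m * Real.exp (m * x)) x := fun x => by
    simpa [mul_comm] using ((hasDerivAt_id x).const_mul m).exp
  have h : AntitoneOn (fun x => (m * L₂ x - M) * Real.exp (m * x)) (Icc 0 1) := by
    refine antitoneOn_of_hasDerivWithinAt le_rfl le_rfl
      (f' := fun x => m * d1 L₂ x * Real.exp (m * x) + (m * L₂ x - M) * (m * Real.exp (m * x)))
      (fun x hx => (((hLd x hx).hasDerivWithinAt.const_mul m).sub_const M).mul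
        (hd x).hasDerivWithinAt) fun x hx => ?_
    have h1 := mul_nonneg (mul_pos hm (Real.exp_pos (m * x))).le
      (sub_nonneg.2 (hL x (Ioo_subset_Icc_self hx)))
    linarith
  have h1 := h (show (0 : ℝ) ∈ Icc (0 : ℝ) 1 by simp) hx hx.1
  simp only [hL0, mul_zero, Real.exp_zero, mul_one, zero_sub] at h1
  have h2 := mul_le_mul_of_nonneg_right h1 (Real.exp_pos (-(m * x))).le
  rw [mul_assoc, ← Real.exp_add, add_neg_cancel, Real.exp_zero, mul_one] at h2
  linarith

theorem IsSupersolution.lipschitz_mul_abs_d1_le (hP : IsPositiveProblem m l₁ l₂ ξ η)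
    (hw : IsSupersolution m l₁ l₂ ξ η w) {L M x : ℝ} (hx : x ∈ Icc (0 : ℝ) 1) (hL : 0 ≤ L)
    (hM : 0 ≤ M) (hLM : m * L ≤ M * (1 - Real.exp (-(m * x)))) :
    L * |d1 w x| ≤ M * w x := by
  have hm := hP.m_pos
  have hwx := hw.nonneg hP hx
  refine le_of_mul_le_mul_left ?_ hm
  rcases le_total 0 (d1 w x) with h | h
  · rw [abs_of_nonneg h]
    have h1 := mul_le_mul_of_nonneg_right hLM h
    have h2 := mul_le_mul_of_nonneg_left (hw.one_sub_exp_mul_d1_le hP hx) hM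
    linarith
  · rw [abs_of_nonpos h]
    have h1 : m * L ≤ M := hLM.trans (mul_le_of_le_one_right hM
      (by linarith [Real.exp_pos (-(m * x))]))
    have h2 := mul_le_mul_of_nonneg_left (neg_le.1 (hw.neg_mul_le_d1 hP hx))
      (mul_nonneg hm.le hL)
    have h3 := mul_le_mul_of_nonneg_right h1 (mul_nonneg hm.le hwx)
    linarith

end Supersolution

/-! ### Solvability of the linear problem -/

theorem IsPositiveProblem.exists_isLinearSolution {m l₁ l₂ ξ η : ℝ}
    (hP : IsPositiveProblem m l₁ l₂ ξ η) {g : ℝ → ℝ} (hg : ContinuousOn g (Icc 0 1)) :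
    ∃ u, IsLinearSolution (-m ^ 2) g l₁ l₂ ξ η u := by
  have hm := hP.m_pos
  have hG := continuous_comp_clamp hg
  set G : ℝ → ℝ := fun x => g (max 0 (min 1 x)) with hGdef
  set S : ℝ → ℝ := fun x => ∫ t in (0 : ℝ)..x, Real.sinh (m * (t - 0)) * G t with hS
  set C : ℝ → ℝ := fun x => ∫ t in (0 : ℝ)..x, Real.cosh (m * (t - 0)) * G t with hC
  have hSd : ∀ x, HasDerivAt S (Real.sinh (m * (x - 0)) * G x) x := fun x =>
    (Continuous.integral_hasStrictDerivAt (by fun_prop) 0 x).hasDerivAt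
  have hCd : ∀ x, HasDerivAt C (Real.cosh (m * (x - 0)) * G x) x := fun x =>
    (Continuous.integral_hasStrictDerivAt (by fun_prop) 0 x).hasDerivAt
  have hsh := hasDerivAt_sinh_mul m 0
  have hch := hasDerivAt_cosh_mul m 0
  -- Variation of constants: `u₀'' = m² u₀ - g` and `u₀(0) = u₀'(0) = 0`.
  set u₀ : ℝ → ℝ := fun x =>
    m⁻¹ * (Real.cosh (m * (x - 0)) * S x - Real.sinh (m * (x - 0)) * C x) with hu₀
  set u₁ : ℝ → ℝ := fun x =>
    Real.sinh (m * (x - 0)) * S x - Real.cosh (m * (x - 0)) * C x with hu₁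
  have hu₀d : ∀ x, HasDerivAt u₀ (u₁ x) x := fun x => by
    refine ((((hch x).mul (hSd x)).sub ((hsh x).mul (hCd x))).const_mul m⁻¹).congr_deriv ?_
    simp only [hu₁]
    field_simp
    ring
  have hu₁d : ∀ x, HasDerivAt u₁ (m ^ 2 * u₀ x - G x) x := fun x => by
    refine (((hsh x).mul (hSd x)).sub ((hch x).mul (hCd x))).congr_deriv ?_
    have := Real.cosh_sq (m * (x - 0))
    simp only [hu₀]
    field_simp
    linear_combination (-G x) * this
  have hu₀0 : u₀ 0 = 0 := by simp [hu₀, hS]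
  have hu₁0 : u₁ 0 = 0 := by simp [hu₁, hC]
  -- A multiple of `sinh(m x)` corrects the condition at `0`, a multiple of `homSol` the one at `1`.
  have hB0 : m - l₁ * Real.sinh (m * (ξ - 0)) ≠ 0 := by
    rw [sub_zero]
    exact (sub_pos.2 hP.sinh_lt).ne'
  obtain ⟨B, hB⟩ : ∃ B, B * (m - l₁ * Real.sinh (m * (ξ - 0))) = l₁ * u₀ ξ :=
    ⟨_, div_mul_cancel₀ _ hB0⟩
  obtain ⟨A, hA⟩ : ∃ A, A * (homSolDeriv m l₁ ξ 1 - l₂ * homSol m l₁ ξ η)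
      = l₂ * (u₀ η + B * Real.sinh (m * (η - 0)))
        - (u₁ 1 + B * (m * Real.cosh (m * (1 - 0)))) :=
    ⟨_, div_mul_cancel₀ _ hP.homSol_right.ne'⟩
  set u : ℝ → ℝ := fun x => u₀ x + B * Real.sinh (m * (x - 0)) + A * homSol m l₁ ξ x with hu
  set v : ℝ → ℝ := fun x =>
    u₁ x + B * (m * Real.cosh (m * (x - 0))) + A * homSolDeriv m l₁ ξ x with hv
  have hud : ∀ x ∈ Icc (0 : ℝ) 1, HasDerivWithinAt u (v x) (Icc 0 1) x := fun x _ =>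
    (((hu₀d x).add ((hsh x).const_mul B)).add
      ((hasDerivAt_homSol m l₁ ξ x).const_mul A)).hasDerivWithinAt
  have hvd : ∀ x ∈ Icc (0 : ℝ) 1,
      HasDerivWithinAt v (m ^ 2 * u x - G x) (Icc 0 1) x := fun x _ => by
    refine (((hu₁d x).add (((hch x).const_mul m).const_mul B)).add
      ((hasDerivAt_homSolDeriv m l₁ ξ x).const_mul A)).hasDerivWithinAt.congr_deriv ?_
    simp only [hu]
    ring
  refine ⟨u, contDiffOn_two_of_hasDerivWithinAt hud hvd ?_, fun x hx => ?_, ?_, ?_⟩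
  · exact ((HasDerivWithinAt.continuousOn hud).const_mul _).sub hG.continuousOn
  · have hx' := Ioo_subset_Icc_self hx
    rw [d2_eq (f := fun x => m ^ 2 * u x - G x) hx' hud (hvd x hx')]
    simp only [hGdef, clamp_eq hx']
    ring
  · rw [d1_eq (by simp) (hud 0 (by simp))]
    have h0 := homSol_zero m l₁ ξ
    have h1 := homSolDeriv_zero m l₁ ξ
    simp only [hv, hu, hu₁0, h1, homSol, sub_zero, sub_self, mul_zero, Real.cosh_zero,
      Real.sinh_zero] at hB ⊢
    linarith
  · rw [d1_eq (by simp) (hud 1 (by simp))]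
    simp only [hv, hu]
    linarith

/-! ### One step of the iteration -/

/-- The right-hand side `ψ(x, u, u') + m² u` of the linear problem that defines the successor
of `u`. -/
noncomputable def shiftedRHS (ψ : ℝ → ℝ → ℝ → ℝ) (m : ℝ) (u : ℝ → ℝ) (x : ℝ) : ℝ :=
  ψ x (u x) (d1 u x) - -m ^ 2 * u x

/-- Between `c` and `d`, adding a supersolution of the linear problem increases `shiftedRHS`. -/
def IsMonotoneRHS (ψ : ℝ → ℝ → ℝ → ℝ) (m l₁ l₂ ξ η : ℝ) (c d : ℝ → ℝ) : Prop :=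
  ∀ u v : ℝ → ℝ, ContDiffOn ℝ 2 u (Icc 0 1) → ContDiffOn ℝ 2 v (Icc 0 1) →
    (∀ x ∈ Icc (0 : ℝ) 1, c x ≤ u x) → (∀ x ∈ Icc (0 : ℝ) 1, v x ≤ d x) →
    IsSupersolution m l₁ l₂ ξ η (v - u) →
    ∀ x ∈ Icc (0 : ℝ) 1, shiftedRHS ψ m u x ≤ shiftedRHS ψ m v x

section Iteration

variable {ψ : ℝ → ℝ → ℝ → ℝ} {m l₁ l₂ ξ η : ℝ} {c d u v : ℝ → ℝ}

theorem isMonotoneRHS (hP : IsPositiveProblem m l₁ l₂ ξ η) {L₁ : ℝ} {L₂ : ℝ → ℝ}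
    (hψL₁ : ∀ x v₁ v₂ w, (x, v₁, w) ∈ region c d → (x, v₂, w) ∈ region c d → v₁ ≤ v₂ →
      -L₁ * (v₂ - v₁) ≤ ψ x v₂ w - ψ x v₁ w)
    (hL₂ : ∀ x ∈ Icc (0 : ℝ) 1, 0 ≤ L₂ x)
    (hψL₂ : ∀ x v w₁ w₂, (x, v, w₁) ∈ region c d → (x, v, w₂) ∈ region c d →
      |ψ x v w₁ - ψ x v w₂| ≤ L₂ x * |w₁ - w₂|)
    (hL₁ : L₁ ≤ m ^ 2) (hL₂0 : L₂ 0 = 0) (hL₂d : DifferentiableOn ℝ L₂ (Icc 0 1))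
    (hsup : ∀ x ∈ Icc (0 : ℝ) 1, d1 L₂ x + L₂ x * m ≤ m ^ 2 - L₁) :
    IsMonotoneRHS ψ m l₁ l₂ ξ η c d := by
  intro u v hu hv hcu hvd hw x hx
  have huv : u x ≤ v x := sub_nonneg.1 (hw.nonneg hP hx)
  have hmu : ∀ w, (x, u x, w) ∈ region c d := fun w =>
    ⟨hx, hcu x hx, huv.trans (hvd x hx)⟩
  have hmv : ∀ w, (x, v x, w) ∈ region c d := fun w =>
    ⟨hx, (hcu x hx).trans huv, hvd x hx⟩
  have h1 := hw.lipschitz_mul_abs_d1_le hP hx (hL₂ x hx) (sub_nonneg.2 hL₁)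
    (mul_lipschitz_le hP.m_pos hL₂0 hL₂d hsup hx)
  rw [d1_sub hu hv hx, Pi.sub_apply] at h1
  have h2 := (abs_le.1 (hψL₂ x (v x) (d1 v x) (d1 u x) (hmv _) (hmv _))).1
  have h3 := hψL₁ x (u x) (v x) (d1 u x) (hmu _) (hmv _) huv
  unfold shiftedRHS
  linarith

theorem continuousOn_shiftedRHS
    (hψ : ContinuousOn (fun p : ℝ × ℝ × ℝ => ψ p.1 p.2.1 p.2.2) (region c d))
    (hu : ContDiffOn ℝ 2 u (Icc 0 1)) (hcu : ∀ x ∈ Icc (0 : ℝ) 1, c x ≤ u x)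
    (hud : ∀ x ∈ Icc (0 : ℝ) 1, u x ≤ d x) : ContinuousOn (shiftedRHS ψ m u) (Icc 0 1) := by
  have h1 : ContinuousOn (fun x => (x, u x, d1 u x)) (Icc 0 1) :=
    continuousOn_id.prodMk (hu.continuousOn.prodMk (contDiffOn_d1 hu).continuousOn)
  exact (hψ.comp h1 fun x hx => ⟨hx, hcu x hx, hud x hx⟩).sub (hu.continuousOn.const_mul _)

theorem isSupersolution_sub_of_isLinearSolution {g₁ g₂ : ℝ → ℝ}
    (hu : IsLinearSolution (-m ^ 2) g₁ l₁ l₂ ξ η u) (hv : IsLinearSolution (-m ^ 2) g₂ l₁ l₂ ξ η v)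
    (h : ∀ x ∈ Icc (0 : ℝ) 1, g₁ x ≤ g₂ x) : IsSupersolution m l₁ l₂ ξ η (v - u) := by
  refine isSupersolution_sub hu.contDiff hv.contDiff (fun x hx => ?_) hu.left hv.left
    hu.right.le hv.right.ge
  linarith [hu.eq x hx, hv.eq x hx, h x (Ioo_subset_Icc_self hx)]

theorem isSupersolution_sub_lower (hc : IsLowerSolution ψ l₁ l₂ ξ η c) {g : ℝ → ℝ}
    (hv : IsLinearSolution (-m ^ 2) g l₁ l₂ ξ η v)
    (h : ∀ x ∈ Icc (0 : ℝ) 1, shiftedRHS ψ m c x ≤ g x) :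
    IsSupersolution m l₁ l₂ ξ η (v - c) := by
  refine isSupersolution_sub hc.contDiff hv.contDiff (fun x hx => ?_) hc.left hv.left
    hc.right hv.right.ge
  have h1 := h x (Ioo_subset_Icc_self hx)
  unfold shiftedRHS at h1
  linarith [hc.ineq x hx, hv.eq x hx]

theorem isSupersolution_upper_sub (hd : IsUpperSolution ψ l₁ l₂ ξ η d) {g : ℝ → ℝ}
    (hu : IsLinearSolution (-m ^ 2) g l₁ l₂ ξ η u)
    (h : ∀ x ∈ Icc (0 : ℝ) 1, g x ≤ shiftedRHS ψ m d x) :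
    IsSupersolution m l₁ l₂ ξ η (d - u) := by
  refine isSupersolution_sub hu.contDiff hd.contDiff (fun x hx => ?_) hu.left hd.left
    hu.right.le hd.right
  have h1 := h x (Ioo_subset_Icc_self hx)
  unfold shiftedRHS at h1
  linarith [hd.ineq x hx, hu.eq x hx]

/-- The order relations `c ≤ u ≤ v ≤ d`, for the functions and for the right-hand sides, that
are preserved by the iteration. -/
structure IsOrderedPair (ψ : ℝ → ℝ → ℝ → ℝ) (m : ℝ) (c d u v : ℝ → ℝ) : Prop where
  contDiff_left : ContDiffOn ℝ 2 u (Icc 0 1)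
  contDiff_right : ContDiffOn ℝ 2 v (Icc 0 1)
  lower_le : ∀ x ∈ Icc (0 : ℝ) 1, c x ≤ u x
  le : ∀ x ∈ Icc (0 : ℝ) 1, u x ≤ v x
  le_upper : ∀ x ∈ Icc (0 : ℝ) 1, v x ≤ d x
  rhs_lower_le : ∀ x ∈ Icc (0 : ℝ) 1, shiftedRHS ψ m c x ≤ shiftedRHS ψ m u x
  rhs_le : ∀ x ∈ Icc (0 : ℝ) 1, shiftedRHS ψ m u x ≤ shiftedRHS ψ m v x
  rhs_le_upper : ∀ x ∈ Icc (0 : ℝ) 1, shiftedRHS ψ m v x ≤ shiftedRHS ψ m d x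

theorem IsOrderedPair.left_le_upper (h : IsOrderedPair ψ m c d u v) :
    ∀ x ∈ Icc (0 : ℝ) 1, u x ≤ d x := fun x hx => (h.le x hx).trans (h.le_upper x hx)

theorem IsOrderedPair.lower_le_right (h : IsOrderedPair ψ m c d u v) :
    ∀ x ∈ Icc (0 : ℝ) 1, c x ≤ v x := fun x hx => (h.lower_le x hx).trans (h.le x hx)

theorem IsOrderedPair.succ (hP : IsPositiveProblem m l₁ l₂ ξ η)
    (hR : IsMonotoneRHS ψ m l₁ l₂ ξ η c d)
    (hc : IsLowerSolution ψ l₁ l₂ ξ η c) (hd : IsUpperSolution ψ l₁ l₂ ξ η d)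
    (h : IsOrderedPair ψ m c d u v) {u' v' : ℝ → ℝ}
    (hu' : IsLinearSolution (-m ^ 2) (shiftedRHS ψ m u) l₁ l₂ ξ η u')
    (hv' : IsLinearSolution (-m ^ 2) (shiftedRHS ψ m v) l₁ l₂ ξ η v') :
    IsOrderedPair ψ m c d u' v' := by
  have h1 := isSupersolution_sub_lower hc hu' h.rhs_lower_le
  have h2 := isSupersolution_sub_of_isLinearSolution hu' hv' h.rhs_le
  have h3 := isSupersolution_upper_sub hd hv' h.rhs_le_upper
  have o1 : ∀ x ∈ Icc (0 : ℝ) 1, c x ≤ u' x := fun x hx => sub_nonneg.1 (h1.nonneg hP hx)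
  have o2 : ∀ x ∈ Icc (0 : ℝ) 1, u' x ≤ v' x := fun x hx => sub_nonneg.1 (h2.nonneg hP hx)
  have o3 : ∀ x ∈ Icc (0 : ℝ) 1, v' x ≤ d x := fun x hx => sub_nonneg.1 (h3.nonneg hP hx)
  exact ⟨hu'.contDiff, hv'.contDiff, o1, o2, o3,
    hR c u' hc.contDiff hu'.contDiff (fun _ _ => le_rfl)
      (fun x hx => (o2 x hx).trans (o3 x hx)) h1,
    hR u' v' hu'.contDiff hv'.contDiff o1 o3 h2,
    hR v' d hv'.contDiff hd.contDiff (fun x hx => (o1 x hx).trans (o2 x hx))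
      (fun _ _ => le_rfl) h3⟩

/-! ### The iterations and their limits -/

theorem d1_congr (h : ∀ x ∈ Icc (0 : ℝ) 1, u x = v x) {x : ℝ} (hx : x ∈ Icc (0 : ℝ) 1) :
    d1 u x = d1 v x :=
  derivWithin_congr h (h x hx)

theorem d2_congr (h : ∀ x ∈ Icc (0 : ℝ) 1, u x = v x) {x : ℝ} (hx : x ∈ Icc (0 : ℝ) 1) :
    d2 u x = d2 v x :=
  d1_congr (fun _ hy => d1_congr h hy) hx

theorem IsSupersolution.congr (hP : IsPositiveProblem m l₁ l₂ ξ η)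
    (hv : IsSupersolution m l₁ l₂ ξ η v) (h : ∀ x ∈ Icc (0 : ℝ) 1, u x = v x) :
    IsSupersolution m l₁ l₂ ξ η u where
  contDiff := hv.contDiff.congr h
  ineq x hx := by
    rw [d2_congr h (Ioo_subset_Icc_self hx), h x (Ioo_subset_Icc_self hx)]
    exact hv.ineq x hx
  left := by
    rw [d1_congr h (by simp), h ξ ⟨hP.ξ_pos.le, hP.ξ_lt.le⟩]
    exact hv.left
  right := by
    rw [d1_congr h (by simp), h η ⟨hP.η_pos.le, hP.η_lt.le⟩]
    exact hv.right

theorem IsIteration.isOrderedPair (hP : IsPositiveProblem m l₁ l₂ ξ η)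
    (hR : IsMonotoneRHS ψ m l₁ l₂ ξ η c d)
    (hc : IsLowerSolution ψ l₁ l₂ ξ η c) (hd : IsUpperSolution ψ l₁ l₂ ξ η d)
    (h0 : IsOrderedPair ψ m c d c d) {cs ds : ℕ → ℝ → ℝ}
    (hcs : IsIteration ψ (-m ^ 2) l₁ l₂ ξ η c cs) (hds : IsIteration ψ (-m ^ 2) l₁ l₂ ξ η d ds) :
    ∀ n, IsOrderedPair ψ m c d (cs n) (ds n)
  | 0 => by
    have e1 : ∀ x ∈ Icc (0 : ℝ) 1, shiftedRHS ψ m (cs 0) x = shiftedRHS ψ m c x := fun x hx => by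
      simp only [shiftedRHS, hcs.zero x hx, d1_congr hcs.zero hx]
    have e2 : ∀ x ∈ Icc (0 : ℝ) 1, shiftedRHS ψ m (ds 0) x = shiftedRHS ψ m d x := fun x hx => by
      simp only [shiftedRHS, hds.zero x hx, d1_congr hds.zero hx]
    exact ⟨hc.contDiff.congr hcs.zero, hd.contDiff.congr hds.zero,
      fun x hx => (hcs.zero x hx).ge,
      fun x hx => by rw [hcs.zero x hx, hds.zero x hx]; exact h0.le x hx,
      fun x hx => (hds.zero x hx).le, fun x hx => (e1 x hx).ge,
      fun x hx => by rw [e1 x hx, e2 x hx]; exact h0.rhs_le x hx, fun x hx => (e2 x hx).le⟩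
  | n + 1 => (hcs.isOrderedPair hP hR hc hd h0 hds n).succ hP hR hc hd (hcs.succ n) (hds.succ n)

/-- Both iterations are constructed together, since solvability at each step needs the iterates
to stay between `c` and `d`. -/
theorem exists_isIteration (hP : IsPositiveProblem m l₁ l₂ ξ η)
    (hR : IsMonotoneRHS ψ m l₁ l₂ ξ η c d)
    (hψ : ContinuousOn (fun p : ℝ × ℝ × ℝ => ψ p.1 p.2.1 p.2.2) (region c d))
    (hc : IsLowerSolution ψ l₁ l₂ ξ η c) (hd : IsUpperSolution ψ l₁ l₂ ξ η d)
    (h0 : IsOrderedPair ψ m c d c d) :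
    (∃ cs, IsIteration ψ (-m ^ 2) l₁ l₂ ξ η c cs) ∧
      ∃ ds, IsIteration ψ (-m ^ 2) l₁ l₂ ξ η d ds := by
  have hT : ∀ u : ℝ → ℝ, ∃ u', ContinuousOn (shiftedRHS ψ m u) (Icc 0 1) →
      IsLinearSolution (-m ^ 2) (shiftedRHS ψ m u) l₁ l₂ ξ η u' := fun u => by
    by_cases h : ContinuousOn (shiftedRHS ψ m u) (Icc 0 1)
    · obtain ⟨u', hu'⟩ := hP.exists_isLinearSolution h
      exact ⟨u', fun _ => hu'⟩
    · exact ⟨0, fun h' => absurd h' h⟩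
  choose T hT using hT
  have hsucc : ∀ {u v}, IsOrderedPair ψ m c d u v →
      IsLinearSolution (-m ^ 2) (shiftedRHS ψ m u) l₁ l₂ ξ η (T u) ∧
      IsLinearSolution (-m ^ 2) (shiftedRHS ψ m v) l₁ l₂ ξ η (T v) := fun h =>
    ⟨hT _ (continuousOn_shiftedRHS hψ h.contDiff_left h.lower_le h.left_le_upper),
      hT _ (continuousOn_shiftedRHS hψ h.contDiff_right h.lower_le_right h.le_upper)⟩
  have hord : ∀ n, IsOrderedPair ψ m c d (T^[n] c) (T^[n] d) := fun n => by
    induction n with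
    | zero => exact h0
    | succ n ih =>
      rw [Function.iterate_succ_apply', Function.iterate_succ_apply']
      exact ih.succ hP hR hc hd (hsucc ih).1 (hsucc ih).2
  refine ⟨⟨fun n => T^[n] c, fun _ _ => rfl, fun n => ?_⟩,
    ⟨fun n => T^[n] d, fun _ _ => rfl, fun n => ?_⟩⟩
  · rw [Function.iterate_succ_apply']
    exact (hsucc (hord n)).1
  · rw [Function.iterate_succ_apply']
    exact (hsucc (hord n)).2

/-- A sequence between `c` and `d` whose increments, up to the sign `s`, are supersolutions
converges uniformly together with its derivatives. -/
theorem exists_tendstoUniformlyOn_of_isSupersolution (hP : IsPositiveProblem m l₁ l₂ ξ η)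
    {us : ℕ → ℝ → ℝ} {s : ℝ} (hs : s = 1 ∨ s = -1) (hus : ∀ n, ContDiffOn ℝ 2 (us n) (Icc 0 1))
    (hcu : ∀ n, ∀ x ∈ Icc (0 : ℝ) 1, c x ≤ us n x) (hud : ∀ n, ∀ x ∈ Icc (0 : ℝ) 1, us n x ≤ d x)
    (h : ∀ n, IsSupersolution m l₁ l₂ ξ η (s • (us (n + 1) - us n))) :
    ∃ y v : ℝ → ℝ, TendstoUniformlyOn us y atTop (Icc 0 1) ∧
      TendstoUniformlyOn (fun n => d1 (us n)) v atTop (Icc 0 1) := by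
  have h1m : (1 : ℝ) ∈ Icc (0 : ℝ) 1 := by simp
  have habs : ∀ t : ℝ, |s * t| = |t| := fun t => by rcases hs with rfl | rfl <;> simp
  have hd1 : ∀ n, ∀ x ∈ Icc (0 : ℝ) 1,
      d1 (s • (us (n + 1) - us n)) x = s * (d1 (us (n + 1)) x - d1 (us n) x) := fun n x hx =>
    d1_eq (v := fun x => s * (d1 (us (n + 1)) x - d1 (us n) x)) hx
      (((hasDerivWithinAt_d1 (hus (n + 1)) hx).sub
        (hasDerivWithinAt_d1 (hus n) hx)).const_mul s)
  have hmono : ∀ n, s * us n 1 ≤ s * us (n + 1) 1 := fun n => by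
    have := (h n).nonneg hP h1m
    simp only [Pi.smul_apply, Pi.sub_apply, smul_eq_mul] at this
    linarith
  have hbdd : ∀ n, s * us n 1 ≤ max (d 1) (-c 1) := fun n => by
    rcases hs with rfl | rfl
    · exact le_max_of_le_left (by linarith [hud n 1 h1m])
    · exact le_max_of_le_right (by linarith [hcu n 1 h1m])
  obtain ⟨y, hy⟩ := exists_tendstoUniformlyOn_of_increments (f := us) (s := Icc 0 1)
    (a := fun n => s * us n 1) (C := Real.exp m) (fun n x hx => by
      have h1 := (h n).le_exp_mul hP hx
      have h2 := (h n).nonneg hP hx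
      simp only [Pi.smul_apply, Pi.sub_apply, smul_eq_mul] at h1 h2
      rw [← habs, abs_of_nonneg h2, ← mul_sub]
      exact h1) hmono hbdd
  obtain ⟨v, hv⟩ := exists_tendstoUniformlyOn_of_increments (f := fun n => d1 (us n))
    (s := Icc 0 1) (a := fun n => s * us n 1) (C := (l₁ + m + m ^ 2) * Real.exp m)
    (fun n x hx => by
      have h1 := (h n).abs_d1_le hP hx
      rw [hd1 n x hx, habs] at h1
      simp only [Pi.smul_apply, Pi.sub_apply, smul_eq_mul] at h1
      rw [← mul_sub]
      exact h1) hmono hbdd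
  exact ⟨y, v, hy, hv⟩

theorem exists_bound_of_tendstoUniformlyOn {f : ℕ → ℝ → ℝ} {g : ℝ → ℝ}
    (hfg : TendstoUniformlyOn f g atTop (Icc 0 1)) (hf : ∀ n, ContinuousOn (f n) (Icc 0 1)) :
    ContinuousOn g (Icc 0 1) ∧ ∃ B, ∀ᶠ n in atTop, ∀ x ∈ Icc (0 : ℝ) 1, |f n x| ≤ B := by
  have hg : ContinuousOn g (Icc 0 1) := hfg.continuousOn (Frequently.of_forall hf)
  obtain ⟨B, hB⟩ := isCompact_Icc.exists_bound_of_continuousOn hg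
  refine ⟨hg, B + 1, ?_⟩
  filter_upwards [Metric.tendstoUniformlyOn_iff.1 hfg 1 one_pos] with n hn x hx
  have h1 := hn x hx
  have h2 := hB x hx
  rw [Real.dist_eq] at h1
  rw [Real.norm_eq_abs] at h2
  rw [abs_lt] at h1
  rw [abs_le] at h2 ⊢
  constructor <;> linarith

/-- The `C¹` limit of an iteration is a solution of the nonlinear problem; the convergence of the
second derivatives in the open interval is only pointwise and bounded. -/
theorem IsIteration.isSolution_of_tendsto {us : ℕ → ℝ → ℝ} {u₀ y v : ℝ → ℝ}
    (hψ : ContinuousOn (fun p : ℝ × ℝ × ℝ => ψ p.1 p.2.1 p.2.2) (region c d))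
    (hit : IsIteration ψ (-m ^ 2) l₁ l₂ ξ η u₀ us)
    (hξ : ξ ∈ Icc (0 : ℝ) 1) (hη : η ∈ Icc (0 : ℝ) 1)
    (hus : ∀ n, ContDiffOn ℝ 2 (us n) (Icc 0 1))
    (hcu : ∀ n, ∀ x ∈ Icc (0 : ℝ) 1, c x ≤ us n x) (hud : ∀ n, ∀ x ∈ Icc (0 : ℝ) 1, us n x ≤ d x)
    {B : ℝ} (hB : ∀ n, ∀ x ∈ Icc (0 : ℝ) 1, |shiftedRHS ψ m (us n) x| ≤ B)
    (hy : TendstoUniformlyOn us y atTop (Icc 0 1))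
    (hv : TendstoUniformlyOn (fun n => d1 (us n)) v atTop (Icc 0 1)) :
    TendstoC1 us y ∧ IsSolution ψ l₁ l₂ ξ η y := by
  obtain ⟨hyc, By, hBy⟩ := exists_bound_of_tendstoUniformlyOn hy fun n => (hus n).continuousOn
  obtain ⟨hvc, Bv, hBv⟩ := exists_bound_of_tendstoUniformlyOn hv
    fun n => (contDiffOn_d1 (hus n)).continuousOn
  have hyp : ∀ x ∈ Icc (0 : ℝ) 1, Tendsto (fun n => us n x) atTop (𝓝 (y x)) := fun x hx =>
    hy.tendsto_at hx
  have hvp : ∀ x ∈ Icc (0 : ℝ) 1, Tendsto (fun n => d1 (us n) x) atTop (𝓝 (v x)) := fun x hx =>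
    hv.tendsto_at hx
  have hmem : ∀ x ∈ Icc (0 : ℝ) 1, (x, y x, v x) ∈ region c d := fun x hx =>
    ⟨hx, ge_of_tendsto' (hyp x hx) fun n => hcu n x hx,
      le_of_tendsto' (hyp x hx) fun n => hud n x hx⟩
  have hyd : ∀ x ∈ Icc (0 : ℝ) 1, HasDerivWithinAt y (v x) (Icc 0 1) x := fun x hx =>
    hasDerivWithinAt_of_tendsto (fun n => (hus n).continuousOn)
      (fun n x hx => hasDerivAt_d1 (hus n) hx) (fun n => (contDiffOn_d1 (hus n)).continuousOn)
      hBv hyp hvp hvc hx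
  have hψp : ∀ x ∈ Icc (0 : ℝ) 1,
      Tendsto (fun n => ψ x (us n x) (d1 (us n) x)) atTop (𝓝 (ψ x (y x) (v x))) := fun x hx =>
    (hψ _ (hmem x hx)).tendsto.comp (tendsto_nhdsWithin_iff.2
      ⟨tendsto_const_nhds.prodMk_nhds ((hyp x hx).prodMk_nhds (hvp x hx)),
        Eventually.of_forall fun n => ⟨hx, hcu n x hx, hud n x hx⟩⟩)
  have hψc : ContinuousOn (fun x => -ψ x (y x) (v x)) (Icc 0 1) :=
    (hψ.comp (continuousOn_id.prodMk (hyc.prodMk hvc)) hmem).neg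
  have hvd : ∀ x ∈ Icc (0 : ℝ) 1, HasDerivWithinAt v (-ψ x (y x) (v x)) (Icc 0 1) x := by
    intro x hx
    refine hasDerivWithinAt_of_tendsto (f := fun n => d1 (us (n + 1)))
      (f' := fun n x => m ^ 2 * us (n + 1) x - shiftedRHS ψ m (us n) x)
      (g' := fun x => -ψ x (y x) (v x)) (B := m ^ 2 * By + B)
      (fun n => (contDiffOn_d1 (hus (n + 1))).continuousOn) (fun n x hx => ?_)
      (fun n => ((hus (n + 1)).continuousOn.const_mul _).sub
        (continuousOn_shiftedRHS hψ (hus n) (hcu n) (hud n))) ?_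
      (fun x hx => (hvp x hx).comp (tendsto_add_atTop_nat 1)) (fun x hx => ?_) hψc hx
    · refine (hasDerivAt_d2 (hus (n + 1)) hx).congr_deriv ?_
      have := (hit.succ n).eq x hx
      unfold shiftedRHS
      linarith
    · filter_upwards [(tendsto_add_atTop_nat 1).eventually hBy] with n hn x hx
      refine (abs_sub _ _).trans (add_le_add ?_ (hB n x hx))
      rw [abs_mul, abs_of_nonneg (sq_nonneg m)]
      exact mul_le_mul_of_nonneg_left (hn x hx) (sq_nonneg m)
    · have h1 := (((hyp x hx).comp (tendsto_add_atTop_nat 1)).const_mul (m ^ 2)).sub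
        ((hψp x hx).sub ((hyp x hx).const_mul (-m ^ 2)))
      rw [show m ^ 2 * y x - (ψ x (y x) (v x) - -m ^ 2 * y x) = -ψ x (y x) (v x) by ring] at h1
      exact h1
  have hd1 : ∀ x ∈ Icc (0 : ℝ) 1, d1 y x = v x := fun x hx => d1_eq hx (hyd x hx)
  have h0m : (0 : ℝ) ∈ Icc (0 : ℝ) 1 := by simp
  have h1m : (1 : ℝ) ∈ Icc (0 : ℝ) 1 := by simp
  refine ⟨⟨hy, hv.congr_right fun x hx => (hd1 x hx).symm⟩,
    contDiffOn_two_of_hasDerivWithinAt hyd hvd hψc, fun x hx => ?_, ?_, ?_⟩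
  · have hx' := Ioo_subset_Icc_self hx
    rw [d2_eq (f := fun x => -ψ x (y x) (v x)) hx' hyd (hvd x hx'), hd1 x hx', neg_neg]
  · rw [hd1 0 h0m]
    exact tendsto_nhds_unique ((hvp 0 h0m).comp (tendsto_add_atTop_nat 1))
      ((((hyp ξ hξ).comp (tendsto_add_atTop_nat 1)).const_mul l₁).congr
        fun n => ((hit.succ n).left).symm)
  · rw [hd1 1 h1m]
    exact tendsto_nhds_unique ((hvp 1 h1m).comp (tendsto_add_atTop_nat 1))
      ((((hyp η hη).comp (tendsto_add_atTop_nat 1)).const_mul l₂).congr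
        fun n => ((hit.succ n).right).symm)

/-- Successive iterates from the lower solution differ by a supersolution. -/
theorem IsIteration.isSupersolution_lower (hP : IsPositiveProblem m l₁ l₂ ξ η)
    (hR : IsMonotoneRHS ψ m l₁ l₂ ξ η c d) (hc : IsLowerSolution ψ l₁ l₂ ξ η c)
    {cs ds : ℕ → ℝ → ℝ} (hcs : IsIteration ψ (-m ^ 2) l₁ l₂ ξ η c cs)
    (hord : ∀ n, IsOrderedPair ψ m c d (cs n) (ds n)) :
    ∀ n, IsSupersolution m l₁ l₂ ξ η (cs (n + 1) - cs n)
  | 0 => by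
    have h := isSupersolution_sub_lower hc (hcs.succ 0) (hord 0).rhs_lower_le
    have e : ∀ x ∈ Icc (0 : ℝ) 1, (cs (0 + 1) - cs 0) x = (cs (0 + 1) - c) x := fun x hx => by
      rw [Pi.sub_apply, Pi.sub_apply, hcs.zero x hx]
    exact h.congr hP e
  | n + 1 => isSupersolution_sub_of_isLinearSolution (hcs.succ n) (hcs.succ (n + 1))
      (hR _ _ (hord n).contDiff_left (hord (n + 1)).contDiff_left (hord n).lower_le
        (hord (n + 1)).left_le_upper (hcs.isSupersolution_lower hP hR hc hord n))

/-- Successive iterates from the upper solution differ by a supersolution. -/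
theorem IsIteration.isSupersolution_upper (hP : IsPositiveProblem m l₁ l₂ ξ η)
    (hR : IsMonotoneRHS ψ m l₁ l₂ ξ η c d) (hd : IsUpperSolution ψ l₁ l₂ ξ η d)
    {cs ds : ℕ → ℝ → ℝ} (hds : IsIteration ψ (-m ^ 2) l₁ l₂ ξ η d ds)
    (hord : ∀ n, IsOrderedPair ψ m c d (cs n) (ds n)) :
    ∀ n, IsSupersolution m l₁ l₂ ξ η (ds n - ds (n + 1))
  | 0 => by
    have h := isSupersolution_upper_sub hd (hds.succ 0) (hord 0).rhs_le_upper
    have e : ∀ x ∈ Icc (0 : ℝ) 1, (ds 0 - ds (0 + 1)) x = (d - ds (0 + 1)) x := fun x hx => by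
      rw [Pi.sub_apply, Pi.sub_apply, hds.zero x hx]
    exact h.congr hP e
  | n + 1 => isSupersolution_sub_of_isLinearSolution (hds.succ (n + 1)) (hds.succ n)
      (hR _ _ (hord (n + 1)).contDiff_right (hord n).contDiff_right
        (hord (n + 1)).lower_le_right (hord n).le_upper
        (hds.isSupersolution_upper hP hR hd hord n))

end Iteration

end FourPointBVP

theorem mainTheorem2
    (ψ : ℝ → ℝ → ℝ → ℝ) (k l₁ l₂ ξ η : ℝ) (c d : ℝ → ℝ) (L₁ : ℝ) (L₂ : ℝ → ℝ)
    (hk : k < 0) (hξ : 0 < ξ) (hξη : ξ ≤ η) (hη : η < 1) (hl₁ : 0 ≤ l₁) (hl₂ : 0 ≤ l₂)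
    (hdet : FourPointBVP.detNeg k l₁ l₂ ξ η ≠ 0)
    (hA1a : 0 ≤ √|k| * Real.sinh √|k| - l₂ * Real.cosh (√|k| * η))
    (hA1b : √|k| * Real.sinh (√|k| * ξ) + (l₁ - √|k|) * Real.cosh (√|k| * ξ) ≤ 0)
    (hA1c : 0 < √|k| - l₁ * Real.cosh (√|k| * ξ))
    (hc : FourPointBVP.IsLowerSolution ψ l₁ l₂ ξ η c)
    (hd : FourPointBVP.IsUpperSolution ψ l₁ l₂ ξ η d)
    (hcd : ∀ x ∈ Set.Icc (0 : ℝ) 1, c x ≤ d x)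
    (hψ : ContinuousOn (fun p : ℝ × ℝ × ℝ => ψ p.1 p.2.1 p.2.2) (FourPointBVP.region c d))
    (hL₁ : 0 ≤ L₁)
    (hψL₁ : ∀ x v₁ v₂ w, (x, v₁, w) ∈ FourPointBVP.region c d →
      (x, v₂, w) ∈ FourPointBVP.region c d → v₁ ≤ v₂ →
      -L₁ * (v₂ - v₁) ≤ ψ x v₂ w - ψ x v₁ w)
    (hL₂ : ∀ x ∈ Set.Icc (0 : ℝ) 1, 0 ≤ L₂ x)
    (hψL₂ : ∀ x v w₁ w₂, (x, v, w₁) ∈ FourPointBVP.region c d →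
      (x, v, w₂) ∈ FourPointBVP.region c d →
      |ψ x v w₁ - ψ x v w₂| ≤ L₂ x * |w₁ - w₂|)
    (hL₁k : L₁ + k ≤ 0) (hL₂0 : L₂ 0 = 0) (hL₂d : DifferentiableOn ℝ L₂ (Set.Icc 0 1))
    (hsup : ∀ x ∈ Set.Icc (0 : ℝ) 1,
      (L₁ + k) + (FourPointBVP.d1 L₂ x + L₂ x * √|k|) ≤ 0)
    (hdiff : ∀ x ∈ Set.Icc (0 : ℝ) 1,
      0 ≤ ψ x (d x) (FourPointBVP.d1 d x) - ψ x (c x) (FourPointBVP.d1 c x)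
        - k * (d x - c x)) :
    (∃ cs, FourPointBVP.IsIteration ψ k l₁ l₂ ξ η c cs) ∧
    (∃ ds, FourPointBVP.IsIteration ψ k l₁ l₂ ξ η d ds) ∧
    ∀ cs ds : ℕ → ℝ → ℝ,
      FourPointBVP.IsIteration ψ k l₁ l₂ ξ η c cs →
      FourPointBVP.IsIteration ψ k l₁ l₂ ξ η d ds →
      (∀ n, ∀ x ∈ Set.Icc (0 : ℝ) 1,
        cs n x ≤ cs (n + 1) x ∧ cs n x ≤ ds n x ∧ ds (n + 1) x ≤ ds n x) ∧
      ∃ y z : ℝ → ℝ,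
        FourPointBVP.TendstoC1 cs y ∧ FourPointBVP.TendstoC1 ds z ∧
        FourPointBVP.IsSolution ψ l₁ l₂ ξ η y ∧ FourPointBVP.IsSolution ψ l₁ l₂ ξ η z ∧
        ∀ x ∈ Set.Icc (0 : ℝ) 1, c x ≤ y x ∧ y x ≤ z x ∧ z x ≤ d x := by
  have hm : 0 < √|k| := Real.sqrt_pos.2 (abs_pos.2 hk.ne)
  have hsq : √|k| ^ 2 = |k| := Real.sq_sqrt (abs_nonneg k)
  have hkm : k = -√|k| ^ 2 := by rw [hsq, abs_of_neg hk, neg_neg]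
  unfold FourPointBVP.detNeg at hdet
  -- From here on `k` is written as `-m ^ 2`.
  generalize √|k| = m at *
  rw [← hsq] at hdet
  subst hkm
  have hP : FourPointBVP.IsPositiveProblem m l₁ l₂ ξ η :=
    ⟨hm, hl₁, hl₂, hξ, hξη.trans_lt hη, hξ.trans_le hξη, hη,
      (mul_le_mul_of_nonneg_left (Real.sinh_lt_cosh _).le hl₁).trans_lt (sub_pos.1 hA1c),
      (FourPointBVP.det_nonneg hm hl₁ hξη (sub_nonneg.1 hA1a)).lt_of_ne' hdet⟩
  have hR : FourPointBVP.IsMonotoneRHS ψ m l₁ l₂ ξ η c d :=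
    FourPointBVP.isMonotoneRHS hP hψL₁ hL₂ hψL₂ (by linarith) hL₂0 hL₂d
      fun x hx => by linarith [hsup x hx]
  have h0 : FourPointBVP.IsOrderedPair ψ m c d c d :=
    ⟨hc.contDiff, hd.contDiff, fun _ _ => le_rfl, hcd, fun _ _ => le_rfl, fun _ _ => le_rfl,
      fun x hx => by unfold FourPointBVP.shiftedRHS; linarith [hdiff x hx], fun _ _ => le_rfl⟩
  obtain ⟨hcs, hds⟩ := FourPointBVP.exists_isIteration hP hR hψ hc hd h0
  refine ⟨hcs, hds, fun cs ds hcs hds => ?_⟩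
  have hord := hcs.isOrderedPair hP hR hc hd h0 hds
  have hsc := hcs.isSupersolution_lower hP hR hc hord
  have hsd := hds.isSupersolution_upper hP hR hd hord
  have hmc : ∀ n, ∀ x ∈ Icc (0 : ℝ) 1, cs n x ≤ cs (n + 1) x := fun n x hx =>
    sub_nonneg.1 ((hsc n).nonneg hP hx)
  have hmd : ∀ n, ∀ x ∈ Icc (0 : ℝ) 1, ds (n + 1) x ≤ ds n x := fun n x hx =>
    sub_nonneg.1 ((hsd n).nonneg hP hx)
  refine ⟨fun n x hx => ⟨hmc n x hx, (hord n).le x hx, hmd n x hx⟩, ?_⟩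
  -- All right-hand sides lie between the continuous ones of `c` and `d`.
  obtain ⟨B₁, hB₁⟩ := isCompact_Icc.exists_bound_of_continuousOn
    (FourPointBVP.continuousOn_shiftedRHS (m := m) hψ hc.contDiff h0.lower_le hcd)
  obtain ⟨B₂, hB₂⟩ := isCompact_Icc.exists_bound_of_continuousOn
    (FourPointBVP.continuousOn_shiftedRHS (m := m) hψ hd.contDiff hcd h0.le_upper)
  have hB : ∀ x ∈ Icc (0 : ℝ) 1, ∀ t, FourPointBVP.shiftedRHS ψ m c x ≤ t →
      t ≤ FourPointBVP.shiftedRHS ψ m d x → |t| ≤ max B₁ B₂ := fun x hx t h1 h2 =>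
    (abs_le_max_abs_abs h1 h2).trans (max_le_max (hB₁ x hx) (hB₂ x hx))
  have hξI : ξ ∈ Icc (0 : ℝ) 1 := ⟨hP.ξ_pos.le, hP.ξ_lt.le⟩
  have hηI : η ∈ Icc (0 : ℝ) 1 := ⟨hP.η_pos.le, hP.η_lt.le⟩
  obtain ⟨y, y', hy, hy'⟩ := FourPointBVP.exists_tendstoUniformlyOn_of_isSupersolution hP
    (us := cs) (s := 1) (Or.inl rfl) (fun n => (hord n).contDiff_left)
    (fun n => (hord n).lower_le) (fun n => (hord n).left_le_upper)
    (fun n => by rw [one_smul]; exact hsc n)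
  obtain ⟨z, z', hz, hz'⟩ := FourPointBVP.exists_tendstoUniformlyOn_of_isSupersolution hP
    (us := ds) (s := -1) (Or.inr rfl) (fun n => (hord n).contDiff_right)
    (fun n => (hord n).lower_le_right) (fun n => (hord n).le_upper)
    (fun n => by rw [neg_one_smul, neg_sub]; exact hsd n)
  obtain ⟨hyC, hyS⟩ := hcs.isSolution_of_tendsto hψ hξI hηI (fun n => (hord n).contDiff_left)
    (fun n => (hord n).lower_le) (fun n => (hord n).left_le_upper)
    (fun n x hx => hB x hx _ ((hord n).rhs_lower_le x hx)
      (((hord n).rhs_le x hx).trans ((hord n).rhs_le_upper x hx))) hy hy'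
  obtain ⟨hzC, hzS⟩ := hds.isSolution_of_tendsto hψ hξI hηI (fun n => (hord n).contDiff_right)
    (fun n => (hord n).lower_le_right) (fun n => (hord n).le_upper)
    (fun n x hx => hB x hx _ (((hord n).rhs_lower_le x hx).trans ((hord n).rhs_le x hx))
      ((hord n).rhs_le_upper x hx)) hz hz'
  refine ⟨y, z, hyC, hzC, hyS, hzS, fun x hx => ?_⟩
  have hyx := hy.tendsto_at hx
  have hzx := hz.tendsto_at hx
  exact ⟨ge_of_tendsto' hyx fun n => (hord n).lower_le x hx,
    le_of_tendsto_of_tendsto' hyx hzx fun n => (hord n).le x hx,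
    le_of_tendsto' hzx fun n => (hord n).le_upper x hx⟩
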